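/- Let $(M,\kappa)$ be a symplectic manifold, i.e. a smooth manifold with a closed non-degenerate $2$-form $\kappa$, and let $J$ be a $\kappa$-calibrated (almost) complex structure on $M$: a smooth section $J$ of $\mathrm{End}(TM)$ with $J^2=-\mathrm{Id}$ and $\kappa(J\cdot,J\cdot)=\kappa(\cdot,\cdot)$ such that $g=g_J:=\kappa(J\cdot,\cdot)$ is positive definite. Let $\nabla$ be the Levi-Civita connection of $g$ and $$B(X,Y)=J(\nabla_XJ)Y-(\nabla_{JX}J)Y .$$ Extend $\nabla$, $J$ and $B$ complex-linearly to $TM\otimes\mathbb C=TM^{(1,0)}\oplus TM^{(0,1)}$ (the eigenbundles of $J$ for $i$ and $-i$) and put $\nabla''_Z:=\nabla_{Z^{(0,1)}}$, where $Z^{(0,1)}=\tfrac12(Z+iJZ)$. Suppose that $\nabla''B=0$; it suffices that $(\nabla''_ZB)(W,H)=0$ for all smooth complex vector fields $Z,W,H$ with $W,H$ of type $(1,0)$. Then the Nijenhuis tensor $$N_J(X,Y)=[JX,JY]-J[JX,Y]-J[X,JY]-[X,Y]$$ vanishes, $J$ is parallel ($\nabla J=0$), and $(g,J,\kappa)$ is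 a Kähler structure on $M$, i.e. $\kappa$ is symplectic, $J$ is $\kappa$-calibrated and integrable (in the sense that $N_J=0$), and $g=g_J$. -/

import Mathlib

open Bundle VectorField
open scoped Manifold ContDiff

namespace AlmostKahler

section LeviCivita

variable {E : Type*} [NormedAddCommGroup E] [NormedSpace ℝ E] [FiniteDimensional ℝ E]
  {M : Type*} [TopologicalSpace M] [ChartedSpace E M] [IsManifold 𝓘(ℝ, E) ∞ M]

/-- `D` is a Levi-Civita connection of the field `g` of symmetric bilinear forms: it is torsion-free
and `v g(Y, Z) = g(∇_v Y, Z) + g(Y, ∇_v Z)`. Mathlib's `D Y x v` is `(∇_v Y)(x)`. -/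
structure IsLeviCivita
    (g : ∀ x : M, TangentSpace 𝓘(ℝ, E) x →L[ℝ] TangentSpace 𝓘(ℝ, E) x →L[ℝ] ℝ)
    (D : CovariantDerivative 𝓘(ℝ, E) E (fun x : M => TangentSpace 𝓘(ℝ, E) x)) : Prop where
  torsion_eq_zero : D.torsion = 0
  metric : ∀ (Y Z : ∀ x : M, TangentSpace 𝓘(ℝ, E) x) (x : M),
    MDiffAt (T% Y) x → MDiffAt (T% Z) x → ∀ v : TangentSpace 𝓘(ℝ, E) x,
      mvfderiv 𝓘(ℝ, E) (fun y => g y (Y y) (Z y)) x v = g x (D Y x v) (Z x) + g x (Y x) (D Z x v)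

/-- The right-hand side of the Koszul formula for `2 g(∇_X Y, Z)`. -/
noncomputable def koszul
    (g : ∀ x : M, TangentSpace 𝓘(ℝ, E) x →L[ℝ] TangentSpace 𝓘(ℝ, E) x →L[ℝ] ℝ)
    (Y X Z : ∀ x : M, TangentSpace 𝓘(ℝ, E) x) (x : M) : ℝ :=
  mvfderiv 𝓘(ℝ, E) (fun y => g y (Y y) (Z y)) x (X x)
    + mvfderiv 𝓘(ℝ, E) (fun y => g y (X y) (Z y)) x (Y x)
    - mvfderiv 𝓘(ℝ, E) (fun y => g y (X y) (Y y)) x (Z x)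
    + g x (mlieBracket 𝓘(ℝ, E) X Y x) (Z x)
    - g x (mlieBracket 𝓘(ℝ, E) X Z x) (Y x)
    - g x (mlieBracket 𝓘(ℝ, E) Y Z x) (X x)

theorem koszul_tensorial_left
    {g : ∀ x : M, TangentSpace 𝓘(ℝ, E) x →L[ℝ] TangentSpace 𝓘(ℝ, E) x →L[ℝ] ℝ}
    (hd : ∀ (Y Z : ∀ x : M, TangentSpace 𝓘(ℝ, E) x) (x : M), MDiffAt (T% Y) x → MDiffAt (T% Z) x →
      MDiffAt (fun y => g y (Y y) (Z y)) x)
    {Y : ∀ x : M, TangentSpace 𝓘(ℝ, E) x} {x : M} (hY : MDiffAt (T% Y) x)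
    (Z : ∀ x : M, TangentSpace 𝓘(ℝ, E) x) (hZ : MDiffAt (T% Z) x) :
    TensorialAt 𝓘(ℝ, E) E (fun X => koszul g Y X Z x) x where
  smul {f X} hf hX := by
    have h1 := mvfderiv_mul hf (hd X Z x hX hZ)
    have h2 := mvfderiv_mul hf (hd X Y x hX hY)
    have e1 : (fun y => g y ((f • X) y) (Z y)) = f * fun y => g y (X y) (Z y) := by
      ext y; simp
    have e2 : (fun y => g y ((f • X) y) (Y y)) = f * fun y => g y (X y) (Y y) := by
      ext y; simp
    simp only [koszul, e1, e2, h1, h2, mlieBracket_smul_left hf hX]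
    simp
    ring
  add {X X'} hX hX' := by
    have h1 := mvfderiv_add (hd X Z x hX hZ) (hd X' Z x hX' hZ)
    have h2 := mvfderiv_add (hd X Y x hX hY) (hd X' Y x hX' hY)
    have e1 : (fun y => g y ((X + X') y) (Z y)) =
        (fun y => g y (X y) (Z y)) + fun y => g y (X' y) (Z y) := by
      ext y; simp
    have e2 : (fun y => g y ((X + X') y) (Y y)) =
        (fun y => g y (X y) (Y y)) + fun y => g y (X' y) (Y y) := by
      ext y; simp
    simp only [koszul, e1, e2, h1, h2, mlieBracket_add_left hX hX']
    simp
    ring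

theorem koszul_tensorial_right
    {g : ∀ x : M, TangentSpace 𝓘(ℝ, E) x →L[ℝ] TangentSpace 𝓘(ℝ, E) x →L[ℝ] ℝ}
    (hs : ∀ x v w, g x v w = g x w v)
    (hd : ∀ (Y Z : ∀ x : M, TangentSpace 𝓘(ℝ, E) x) (x : M), MDiffAt (T% Y) x → MDiffAt (T% Z) x →
      MDiffAt (fun y => g y (Y y) (Z y)) x)
    {Y : ∀ x : M, TangentSpace 𝓘(ℝ, E) x} {x : M} (hY : MDiffAt (T% Y) x)
    (X : ∀ x : M, TangentSpace 𝓘(ℝ, E) x) (hX : MDiffAt (T% X) x) :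
    TensorialAt 𝓘(ℝ, E) E (fun Z => koszul g Y X Z x) x where
  smul {f Z} hf hZ := by
    have h1 := mvfderiv_mul hf (hd Y Z x hY hZ)
    have h2 := mvfderiv_mul hf (hd X Z x hX hZ)
    have e1 : (fun y => g y (Y y) ((f • Z) y)) = f * fun y => g y (Y y) (Z y) := by
      ext y; simp
    have e2 : (fun y => g y (X y) ((f • Z) y)) = f * fun y => g y (X y) (Z y) := by
      ext y; simp
    simp only [koszul, e1, e2, h1, h2, mlieBracket_smul_right hf hZ]
    simp
    rw [hs x (Z x) (Y x), hs x (Z x) (X x)]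
    ring
  add {Z Z'} hZ hZ' := by
    have h1 := mvfderiv_add (hd Y Z x hY hZ) (hd Y Z' x hY hZ')
    have h2 := mvfderiv_add (hd X Z x hX hZ) (hd X Z' x hX hZ')
    have e1 : (fun y => g y (Y y) ((Z + Z') y)) =
        (fun y => g y (Y y) (Z y)) + fun y => g y (Y y) (Z' y) := by
      ext y; simp
    have e2 : (fun y => g y (X y) ((Z + Z') y)) =
        (fun y => g y (X y) (Z y)) + fun y => g y (X y) (Z' y) := by
      ext y; simp
    simp only [koszul, e1, e2, h1, h2, mlieBracket_add_right hZ hZ']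
    simp
    ring

/-- Existence of the vectors `∇_v Y` prescribed by the Koszul formula. -/
theorem exists_koszul
    {g : ∀ x : M, TangentSpace 𝓘(ℝ, E) x →L[ℝ] TangentSpace 𝓘(ℝ, E) x →L[ℝ] ℝ}
    (hs : ∀ x v w, g x v w = g x w v) (hp : ∀ x v, v ≠ 0 → 0 < g x v v)
    (hd : ∀ (Y Z : ∀ x : M, TangentSpace 𝓘(ℝ, E) x) (x : M), MDiffAt (T% Y) x → MDiffAt (T% Z) x →
      MDiffAt (fun y => g y (Y y) (Z y)) x)
    (Y : ∀ x : M, TangentSpace 𝓘(ℝ, E) x) (x : M) :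
    ∃ L : TangentSpace 𝓘(ℝ, E) x →L[ℝ] TangentSpace 𝓘(ℝ, E) x, MDiffAt (T% Y) x →
      ∀ X Z : ∀ x : M, TangentSpace 𝓘(ℝ, E) x, MDiffAt (T% X) x → MDiffAt (T% Z) x →
        2 * g x (L (X x)) (Z x) = koszul g Y X Z x := by
  by_cases hY : MDiffAt (T% Y) x
  swap
  · exact ⟨0, fun h => absurd h hY⟩
  have : FiniteDimensional ℝ (TangentSpace 𝓘(ℝ, E) x) := inferInstanceAs (FiniteDimensional ℝ E)
  have : T2Space (TangentSpace 𝓘(ℝ, E) x) := inferInstanceAs (T2Space E)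
  let K := TensorialAt.mkHom₂ (fun X Z => koszul g Y X Z x) x
    (koszul_tensorial_left hd hY) (koszul_tensorial_right hs hd hY)
  let G : TangentSpace 𝓘(ℝ, E) x →ₗ[ℝ] Module.Dual ℝ (TangentSpace 𝓘(ℝ, E) x) :=
    (ContinuousLinearMap.coeLM ℝ).comp (g x).toLinearMap
  have hG : Function.Injective G := by
    rw [← LinearMap.ker_eq_bot, LinearMap.ker_eq_bot']
    intro v hv
    by_contra hne
    have := hp x v hne
    have h2 : G v v = 0 := by rw [hv]; rfl
    exact absurd h2 this.ne'
  let Ge := LinearEquiv.ofInjectiveOfFinrankEq G hG (Subspace.dual_finrank_eq).symm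
  have hGe : ∀ φ, G (Ge.symm φ) = φ := fun φ => Ge.apply_symm_apply φ
  let K' : TangentSpace 𝓘(ℝ, E) x →ₗ[ℝ] Module.Dual ℝ (TangentSpace 𝓘(ℝ, E) x) :=
    (ContinuousLinearMap.coeLM ℝ).comp K.toLinearMap
  refine ⟨LinearMap.toContinuousLinearMap ((2⁻¹ : ℝ) • (Ge.symm.toLinearMap.comp K')),
    fun _ X Z hX hZ => ?_⟩
  have h1 : g x (Ge.symm (K' (X x))) (Z x) = K (X x) (Z x) :=
    congrArg (fun φ => φ (Z x)) (hGe (K' (X x)))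
  have h2 : K (X x) (Z x) = koszul g Y X Z x := TensorialAt.mkHom₂_apply _ _ hX hZ
  rw [← h2, ← h1]
  simp

/-- The fundamental theorem of Riemannian geometry (existence). -/
theorem exists_isLeviCivita
    {g : ∀ x : M, TangentSpace 𝓘(ℝ, E) x →L[ℝ] TangentSpace 𝓘(ℝ, E) x →L[ℝ] ℝ}
    (hs : ∀ x v w, g x v w = g x w v) (hp : ∀ x v, v ≠ 0 → 0 < g x v v)
    (hd : ∀ (Y Z : ∀ x : M, TangentSpace 𝓘(ℝ, E) x) (x : M), MDiffAt (T% Y) x → MDiffAt (T% Z) x →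
      MDiffAt (fun y => g y (Y y) (Z y)) x) :
    ∃ D : CovariantDerivative 𝓘(ℝ, E) E (fun x : M => TangentSpace 𝓘(ℝ, E) x),
      IsLeviCivita g D := by
  choose L hL using exists_koszul hs hp hd
  have key : ∀ (x : M) (u v : TangentSpace 𝓘(ℝ, E) x),
      (∀ Z : ∀ x : M, TangentSpace 𝓘(ℝ, E) x, MDiffAt (T% Z) x →
        2 * g x u (Z x) = 2 * g x v (Z x)) → u = v := by
    intro x u v h
    by_contra hne
    have h1 := h (FiberBundle.extend E (u - v)) (FiberBundle.mdifferentiableAt_extend ..)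
    have h2 := hp x (u - v) (sub_ne_zero.mpr hne)
    simp at h1 h2
    linarith
  have key2 : ∀ (x : M) (A B : TangentSpace 𝓘(ℝ, E) x →L[ℝ] TangentSpace 𝓘(ℝ, E) x),
      (∀ X Z : ∀ x : M, TangentSpace 𝓘(ℝ, E) x, MDiffAt (T% X) x → MDiffAt (T% Z) x →
        2 * g x (A (X x)) (Z x) = 2 * g x (B (X x)) (Z x)) → A = B := by
    intro x A B h
    ext v
    refine key x _ _ fun Z hZ => ?_
    simpa using h (FiberBundle.extend E v) Z (FiberBundle.mdifferentiableAt_extend ..) hZ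
  let D : CovariantDerivative 𝓘(ℝ, E) E (fun x : M => TangentSpace 𝓘(ℝ, E) x) :=
    { toFun := L
      isCovariantDerivativeOnUniv :=
        { add := by
            intro Y Y' x hY hY' _
            refine key2 x _ _ fun X Z hX hZ => ?_
            have hYY : MDiffAt (T% (Y + Y')) x := mdifferentiableAt_add_section hY hY'
            have h1 := mvfderiv_add (hd Y Z x hY hZ) (hd Y' Z x hY' hZ)
            have h2 := mvfderiv_add (hd X Y x hX hY) (hd X Y' x hX hY')
            have e1 : (fun y => g y ((Y + Y') y) (Z y)) =
                (fun y => g y (Y y) (Z y)) + fun y => g y (Y' y) (Z y) := by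
              ext y; simp
            have e2 : (fun y => g y (X y) ((Y + Y') y)) =
                (fun y => g y (X y) (Y y)) + fun y => g y (X y) (Y' y) := by
              ext y; simp
            have a1 := hL Y x hY X Z hX hZ
            have a2 := hL Y' x hY' X Z hX hZ
            rw [hL _ x hYY X Z hX hZ]
            simp only [add_apply, map_add, mul_add, a1, a2]
            simp only [koszul, e1, e2, h1, h2, mlieBracket_add_right hY hY',
              mlieBracket_add_left hY hY']
            simp
            ring
          leibniz := by
            intro Y f x hY hf _
            refine key2 x _ _ fun X Z hX hZ => ?_
            have hYY : MDiffAt (T% (f • Y)) x := hf.smul_section hY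
            have h1 := mvfderiv_mul hf (hd Y Z x hY hZ)
            have h2 := mvfderiv_mul hf (hd X Y x hX hY)
            have e1 : (fun y => g y ((f • Y) y) (Z y)) = f * fun y => g y (Y y) (Z y) := by
              ext y; simp
            have e2 : (fun y => g y (X y) ((f • Y) y)) = f * fun y => g y (X y) (Y y) := by
              ext y; simp
            have a1 := hL Y x hY X Z hX hZ
            rw [hL _ x hYY X Z hX hZ]
            have a3 : 2 * g x ((f x • L Y x +
                (mvfderiv 𝓘(ℝ, E) f x).smulRight (Y x)) (X x)) (Z x) =
                f x * koszul g Y X Z x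
                  + 2 * (mvfderiv 𝓘(ℝ, E) f x (X x) * g x (Y x) (Z x)) := by
              rw [← a1]
              simp
              ring
            refine Eq.trans ?_ a3.symm
            simp only [koszul, e1, e2, h1, h2, mlieBracket_smul_right hf hY,
              mlieBracket_smul_left hf hY]
            simp
            rw [hs x (Y x) (X x)]
            ring } }
  have hD : ∀ (X Y Z : ∀ x : M, TangentSpace 𝓘(ℝ, E) x) (x : M), MDiffAt (T% X) x →
      MDiffAt (T% Y) x → MDiffAt (T% Z) x → 2 * g x (D Y x (X x)) (Z x) = koszul g Y X Z x :=
    fun X Y Z x hX hY hZ => hL Y x hY X Z hX hZ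
  have sy : ∀ Y Z : ∀ x : M, TangentSpace 𝓘(ℝ, E) x,
      (fun y => g y (Y y) (Z y)) = fun y => g y (Z y) (Y y) :=
    fun Y Z => funext fun y => hs y _ _
  refine ⟨D, ?_, ?_⟩
  · rw [CovariantDerivative.torsion_eq_zero_iff]
    intro X Y x hX hY
    refine key x _ _ fun Z hZ => ?_
    have h1 := hD X Y Z x hX hY hZ
    have h2 := hD Y X Z x hY hX hZ
    simp only [map_sub, sub_apply, mul_sub, h1, h2]
    simp only [koszul, sy Y X, mlieBracket_swap_apply (V := Y) (W := X)]
    simp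
    ring
  · intro Y Z x hY hZ v
    have hX := FiberBundle.mdifferentiableAt_extend 𝓘(ℝ, E) E v
    have h1 := hD _ Y Z x hX hY hZ
    have h2 := hD _ Z Y x hX hZ hY
    rw [FiberBundle.extend_apply_self] at h1 h2
    rw [hs x (Y x)]
    have : 2 * g x (D Y x v) (Z x) + 2 * g x (D Z x v) (Y x) =
        2 * mvfderiv 𝓘(ℝ, E) (fun y => g y (Y y) (Z y)) x v := by
      rw [h1, h2]
      simp only [koszul, sy Z Y, mlieBracket_swap_apply (V := Z) (W := Y)]
      simp
      ring
    linarith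

end LeviCivita

section Structures

variable {E : Type*} [NormedAddCommGroup E] [NormedSpace ℝ E]
  {M : Type*} [TopologicalSpace M] [ChartedSpace E M] [IsManifold 𝓘(ℝ, E) ∞ M]

/-- `X` is a `C^∞` vector field on `M`. -/
def IsSmoothField (X : ∀ x : M, TangentSpace 𝓘(ℝ, E) x) : Prop :=
  CMDiff ∞ (T% X)

/-- The exterior derivative of a 2-form, evaluated on three vector fields. -/
noncomputable def extDerivTwoForm
    (κ : ∀ x : M, TangentSpace 𝓘(ℝ, E) x →L[ℝ] TangentSpace 𝓘(ℝ, E) x →L[ℝ] ℝ)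
    (X Y Z : ∀ x : M, TangentSpace 𝓘(ℝ, E) x) (x : M) : ℝ :=
  mvfderiv 𝓘(ℝ, E) (fun y => κ y (Y y) (Z y)) x (X x)
    - mvfderiv 𝓘(ℝ, E) (fun y => κ y (X y) (Z y)) x (Y x)
    + mvfderiv 𝓘(ℝ, E) (fun y => κ y (X y) (Y y)) x (Z x)
    - κ x (mlieBracket 𝓘(ℝ, E) X Y x) (Z x)
    + κ x (mlieBracket 𝓘(ℝ, E) X Z x) (Y x)
    - κ x (mlieBracket 𝓘(ℝ, E) Y Z x) (X x)

/-- `κ` is a symplectic form: a smooth, closed, non-degenerate 2-form. -/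
structure IsSymplectic
    (κ : ∀ x : M, TangentSpace 𝓘(ℝ, E) x →L[ℝ] TangentSpace 𝓘(ℝ, E) x →L[ℝ] ℝ) : Prop where
  smooth : ContMDiff 𝓘(ℝ, E) (𝓘(ℝ, E).prod 𝓘(ℝ, E →L[ℝ] E →L[ℝ] ℝ)) ∞
    (fun x => TotalSpace.mk' (E →L[ℝ] E →L[ℝ] ℝ)
      (E := fun x : M => TangentSpace 𝓘(ℝ, E) x →L[ℝ] TangentSpace 𝓘(ℝ, E) x →L[ℝ] ℝ) x (κ x))
  alternating : ∀ x v, κ x v v = 0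
  nondegenerate : ∀ x v, (∀ w, κ x v w = 0) → v = 0
  closed : ∀ X Y Z : ∀ x : M, TangentSpace 𝓘(ℝ, E) x,
    IsSmoothField X → IsSmoothField Y → IsSmoothField Z → extDerivTwoForm κ X Y Z = 0

/-- `J` is a `κ`-calibrated (almost) complex structure: a smooth field of endomorphisms with
`J² = -1`, preserving `κ`, such that `κ(J·,·)` is positive definite. -/
structure IsCalibrated
    (κ : ∀ x : M, TangentSpace 𝓘(ℝ, E) x →L[ℝ] TangentSpace 𝓘(ℝ, E) x →L[ℝ] ℝ)
    (J : ∀ x : M, TangentSpace 𝓘(ℝ, E) x →L[ℝ] TangentSpace 𝓘(ℝ, E) x) : Prop where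
  smooth : ContMDiff 𝓘(ℝ, E) (𝓘(ℝ, E).prod 𝓘(ℝ, E →L[ℝ] E)) ∞
    (fun x => TotalSpace.mk' (E →L[ℝ] E)
      (E := fun x : M => TangentSpace 𝓘(ℝ, E) x →L[ℝ] TangentSpace 𝓘(ℝ, E) x) x (J x))
  sq : ∀ x v, J x (J x v) = -v
  invariant : ∀ x v w, κ x (J x v) (J x w) = κ x v w
  pos : ∀ x v, v ≠ 0 → 0 < κ x (J x v) v

/-- The metric `g_J = κ(J·,·)`. -/
noncomputable def calibratedMetric
    (κ : ∀ x : M, TangentSpace 𝓘(ℝ, E) x →L[ℝ] TangentSpace 𝓘(ℝ, E) x →L[ℝ] ℝ)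
    (J : ∀ x : M, TangentSpace 𝓘(ℝ, E) x →L[ℝ] TangentSpace 𝓘(ℝ, E) x) (x : M) :
    TangentSpace 𝓘(ℝ, E) x →L[ℝ] TangentSpace 𝓘(ℝ, E) x →L[ℝ] ℝ :=
  (κ x).comp (J x)

/-- The vector field `JX`. -/
noncomputable def applyJ (J : ∀ x : M, TangentSpace 𝓘(ℝ, E) x →L[ℝ] TangentSpace 𝓘(ℝ, E) x)
    (X : ∀ x : M, TangentSpace 𝓘(ℝ, E) x) : ∀ x : M, TangentSpace 𝓘(ℝ, E) x :=
  fun x => J x (X x)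

/-- The Nijenhuis tensor `N_J(X,Y) = [JX,JY] - J[JX,Y] - J[X,JY] - [X,Y]`. -/
noncomputable def nijenhuis (J : ∀ x : M, TangentSpace 𝓘(ℝ, E) x →L[ℝ] TangentSpace 𝓘(ℝ, E) x)
    (X Y : ∀ x : M, TangentSpace 𝓘(ℝ, E) x) : ∀ x : M, TangentSpace 𝓘(ℝ, E) x :=
  mlieBracket 𝓘(ℝ, E) (applyJ J X) (applyJ J Y)
    - applyJ J (mlieBracket 𝓘(ℝ, E) (applyJ J X) Y)
    - applyJ J (mlieBracket 𝓘(ℝ, E) X (applyJ J Y))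
    - mlieBracket 𝓘(ℝ, E) X Y

/-- `J` is integrable: its Nijenhuis tensor vanishes. -/
def IsIntegrable (J : ∀ x : M, TangentSpace 𝓘(ℝ, E) x →L[ℝ] TangentSpace 𝓘(ℝ, E) x) : Prop :=
  ∀ X Y : ∀ x : M, TangentSpace 𝓘(ℝ, E) x,
    IsSmoothField X → IsSmoothField Y → nijenhuis J X Y = 0

/-- `(g, J, κ)` is a Kähler structure: `κ` is symplectic, `J` is `κ`-calibrated and integrable,
and `g = g_J`. -/
structure IsKahler
    (g : ∀ x : M, TangentSpace 𝓘(ℝ, E) x →L[ℝ] TangentSpace 𝓘(ℝ, E) x →L[ℝ] ℝ)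
    (J : ∀ x : M, TangentSpace 𝓘(ℝ, E) x →L[ℝ] TangentSpace 𝓘(ℝ, E) x)
    (κ : ∀ x : M, TangentSpace 𝓘(ℝ, E) x →L[ℝ] TangentSpace 𝓘(ℝ, E) x →L[ℝ] ℝ) : Prop where
  symplectic : IsSymplectic κ
  calibrated : IsCalibrated κ J
  integrable : IsIntegrable J
  metric : g = calibratedMetric κ J

end Structures

section Connection

variable {E : Type*} [NormedAddCommGroup E] [NormedSpace ℝ E] [FiniteDimensional ℝ E]
  {M : Type*} [TopologicalSpace M] [ChartedSpace E M] [IsManifold 𝓘(ℝ, E) ∞ M]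
  {κ : ∀ x : M, TangentSpace 𝓘(ℝ, E) x →L[ℝ] TangentSpace 𝓘(ℝ, E) x →L[ℝ] ℝ}
  {J : ∀ x : M, TangentSpace 𝓘(ℝ, E) x →L[ℝ] TangentSpace 𝓘(ℝ, E) x}

theorem exists_isLeviCivita_calibratedMetric (hκ : IsSymplectic κ) (hJ : IsCalibrated κ J) :
    ∃ D : CovariantDerivative 𝓘(ℝ, E) E (fun x : M => TangentSpace 𝓘(ℝ, E) x),
      IsLeviCivita (calibratedMetric κ J) D := by
  refine exists_isLeviCivita ?_ hJ.pos ?_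
  · intro x v w
    have h := hκ.alternating x (J x v + w)
    have h1 := hJ.invariant x v (J x w)
    have h2 : κ x (J x v + w) (J x v + w) = κ x (J x v) w + κ x w (J x v) := by
      simp [hκ.alternating]
    have h3 := hJ.invariant x w (J x v)
    rw [hJ.sq, map_neg] at h3
    change κ x (J x v) w = κ x (J x w) v
    linarith
  · intro Y Z x hY hZ
    have hJY : MDiffAt (T% (applyJ J Y)) x :=
      ((hJ.smooth x).mdifferentiableAt (by simp)).clm_bundle_apply hY
    have := MDifferentiableAt.clm_bundle_apply₂ (F₁ := E) (F₂ := E) (F₃ := ℝ)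
      (E₁ := fun x : M => TangentSpace 𝓘(ℝ, E) x) (E₂ := fun x : M => TangentSpace 𝓘(ℝ, E) x)
      (E₃ := fun _ : M => ℝ) (b := fun x : M => x)
      ((hκ.smooth x).mdifferentiableAt (by simp)) hJY hZ
    rw [mdifferentiableAt_totalSpace] at this
    exact this.2

/-- The Levi-Civita connection of `g_J = κ(J·,·)`. -/
noncomputable def leviCivita (hκ : IsSymplectic κ) (hJ : IsCalibrated κ J) :
    CovariantDerivative 𝓘(ℝ, E) E (fun x : M => TangentSpace 𝓘(ℝ, E) x) :=
  (exists_isLeviCivita_calibratedMetric hκ hJ).choose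

theorem leviCivita_spec (hκ : IsSymplectic κ) (hJ : IsCalibrated κ J) :
    IsLeviCivita (calibratedMetric κ J) (leviCivita hκ hJ) :=
  (exists_isLeviCivita_calibratedMetric hκ hJ).choose_spec

end Connection

section Tensors

variable {E : Type*} [NormedAddCommGroup E] [NormedSpace ℝ E]
  {M : Type*} [TopologicalSpace M] [ChartedSpace E M] [IsManifold 𝓘(ℝ, E) ∞ M]
  (D : CovariantDerivative 𝓘(ℝ, E) E (fun x : M => TangentSpace 𝓘(ℝ, E) x))
  (J : ∀ x : M, TangentSpace 𝓘(ℝ, E) x →L[ℝ] TangentSpace 𝓘(ℝ, E) x)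

/-- The vector field `∇_X Y`. -/
noncomputable def nabla (X Y : ∀ x : M, TangentSpace 𝓘(ℝ, E) x) : ∀ x : M, TangentSpace 𝓘(ℝ, E) x :=
  fun x => D Y x (X x)

/-- `(∇_X J)Y = ∇_X(JY) - J(∇_X Y)`. -/
noncomputable def nablaJ (X Y : ∀ x : M, TangentSpace 𝓘(ℝ, E) x) : ∀ x : M, TangentSpace 𝓘(ℝ, E) x :=
  nabla D X (applyJ J Y) - applyJ J (nabla D X Y)

/-- The tensor `B(X,Y) = J(∇_X J)Y - (∇_{JX} J)Y`. -/
noncomputable def tensorB (X Y : ∀ x : M, TangentSpace 𝓘(ℝ, E) x) : ∀ x : M, TangentSpace 𝓘(ℝ, E) x :=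
  applyJ J (nablaJ D J X Y) - nablaJ D J (applyJ J X) Y

variable (E M) in
/-- Complex vector fields, i.e. sections of `TM ⊗ ℂ`; the pair `(X, Y)` stands for `X + iY`. -/
abbrev ComplexField : Type _ :=
  (∀ x : M, TangentSpace 𝓘(ℝ, E) x) × (∀ x : M, TangentSpace 𝓘(ℝ, E) x)

/-- A complex vector field is smooth if its real and imaginary parts are. -/
def ComplexField.IsSmooth (Z : ComplexField E M) : Prop :=
  IsSmoothField Z.1 ∧ IsSmoothField Z.2

/-- Multiplication of a complex vector field by `i`. -/
noncomputable def ComplexField.mulI (Z : ComplexField E M) : ComplexField E M := (-Z.2, Z.1)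

/-- The complex-linear extension of `J`. -/
noncomputable def ComplexField.applyJ (Z : ComplexField E M) : ComplexField E M :=
  (AlmostKahler.applyJ J Z.1, AlmostKahler.applyJ J Z.2)

/-- `Z` is of type `(1,0)`: `JZ = iZ`. -/
def ComplexField.IsTypeOneZero (Z : ComplexField E M) : Prop :=
  Z.applyJ J = Z.mulI

/-- The component `Z^{(0,1)} = (Z + iJZ)/2` of type `(0,1)`. -/
noncomputable def ComplexField.zeroOnePart (Z : ComplexField E M) : ComplexField E M :=
  (2⁻¹ : ℝ) • (Z + (Z.applyJ J).mulI)

/-- The complex-bilinear extension of a real-bilinear operation on vector fields. -/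
noncomputable def complexify₂
    (b : (∀ x : M, TangentSpace 𝓘(ℝ, E) x) → (∀ x : M, TangentSpace 𝓘(ℝ, E) x) →
      (∀ x : M, TangentSpace 𝓘(ℝ, E) x))
    (Z W : ComplexField E M) : ComplexField E M :=
  (b Z.1 W.1 - b Z.2 W.2, b Z.1 W.2 + b Z.2 W.1)

/-- `(∇_Z B)(W,H) = ∇_Z(B(W,H)) - B(∇_Z W, H) - B(W, ∇_Z H)` for complex vector fields. -/
noncomputable def nablaB (Z W H : ComplexField E M) : ComplexField E M :=
  complexify₂ (nabla D) Z (complexify₂ (tensorB D J) W H)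
    - complexify₂ (tensorB D J) (complexify₂ (nabla D) Z W) H
    - complexify₂ (tensorB D J) W (complexify₂ (nabla D) Z H)

/-- `(∇''_Z B)(W,H)`, where `∇''_Z = ∇_{Z^{(0,1)}}`. -/
noncomputable def nablaZeroOneB (Z W H : ComplexField E M) : ComplexField E M :=
  nablaB D J (Z.zeroOnePart J) W H

end Tensors

end AlmostKahler

/-! Write `A_X = ∇_X J` and `g = g_J`. Differentiating `J² = -1` and `g(JY,Z) = -g(Y,JZ)` shows that
`A_X` anticommutes with `J` and is skew-adjoint. Since `∇` is torsion-free, `dκ = 0` says that the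
cyclic sum of `g(A_X Y, Z)` vanishes. Inserting `J` in the arguments then gives the quasi-Kähler
identity `A_{JX} = -J A_X` (`nablaJ_applyJ_left`). Hence `B(X,Y) = 2 J A_X Y`, and `B` is
conjugate-linear for `J` in each slot: its complex extension takes values of type (0,1) as soon as
one argument has type (1,0).

For `W`, `H` of type (1,0), the correction terms `B(∇_Z W, H)` and `B(W, ∇_Z H)` are therefore of
type (0,1). So the (1,0)-part of `(∇''_Z B)(W,H)` comes only from differentiating the (0,1)-field
`B(W,H)`, and measures how far `∇''` fails to preserve that type, which is again a value of `∇J`.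
The hypothesis thus becomes `A_P (A_X Y) = 0` (`nablaJ_nablaJ_eq_zero`). Taking `P = X`,
skew-adjointness gives `|A_X Y|² = -g(A_X A_X Y, Y) = 0`. So `J` is parallel, and a torsion-free
connection with `∇J = 0` forces `N_J = 0`.

Everything is tested on global smooth fields, so `∇_X Y` must be known to be smooth before it can be
used as an argument again; this follows from the Koszul formula. -/

namespace AlmostKahler

open scoped Topology

/-! ### Smooth vector fields and their extension from germs. -/

section SmoothFields

variable {E : Type*} [NormedAddCommGroup E] [NormedSpace ℝ E]
  {M : Type*} [TopologicalSpace M] [ChartedSpace E M] [IsManifold 𝓘(ℝ, E) ∞ M]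

variable {X Y : ∀ x : M, TangentSpace 𝓘(ℝ, E) x}

theorem IsSmoothField.mdifferentiableAt (hX : IsSmoothField X) (x : M) : MDiffAt (T% X) x :=
  (ContMDiff.mdifferentiable hX (by simp)) x

theorem IsSmoothField.add (hX : IsSmoothField X) (hY : IsSmoothField Y) : IsSmoothField (X + Y) :=
  ContMDiff.add_section hX hY

theorem IsSmoothField.sub (hX : IsSmoothField X) (hY : IsSmoothField Y) : IsSmoothField (X - Y) :=
  ContMDiff.sub_section hX hY

theorem IsSmoothField.neg (hX : IsSmoothField X) : IsSmoothField (-X) :=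
  ContMDiff.neg_section hX

theorem IsSmoothField.const_smul (c : ℝ) (hX : IsSmoothField X) : IsSmoothField (c • X) :=
  ContMDiff.const_smul_section hX

theorem IsSmoothField.zero : IsSmoothField (0 : ∀ x : M, TangentSpace 𝓘(ℝ, E) x) :=
  contMDiff_zeroSection ℝ _

theorem IsSmoothField.applyJ {κ : ∀ x : M, TangentSpace 𝓘(ℝ, E) x →L[ℝ] TangentSpace 𝓘(ℝ, E) x →L[ℝ] ℝ}
    {J : ∀ x : M, TangentSpace 𝓘(ℝ, E) x →L[ℝ] TangentSpace 𝓘(ℝ, E) x}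
    (hJ : IsCalibrated κ J) (hX : IsSmoothField X) : IsSmoothField (applyJ J X) :=
  ContMDiff.clm_bundle_apply hJ.smooth hX

theorem IsSymplectic.contMDiff_apply
    {κ : ∀ x : M, TangentSpace 𝓘(ℝ, E) x →L[ℝ] TangentSpace 𝓘(ℝ, E) x →L[ℝ] ℝ}
    (hκ : IsSymplectic κ) (hX : IsSmoothField X) (hY : IsSmoothField Y) :
    ContMDiff 𝓘(ℝ, E) 𝓘(ℝ, ℝ) ∞ (fun y => κ y (X y) (Y y)) := by
  intro x
  have := ContMDiffAt.clm_bundle_apply₂ (F₁ := E) (F₂ := E) (F₃ := ℝ)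
      (E₁ := fun x : M => TangentSpace 𝓘(ℝ, E) x) (E₂ := fun x : M => TangentSpace 𝓘(ℝ, E) x)
      (E₃ := fun _ : M => ℝ) (b := fun x : M => x) (hκ.smooth x) (hX x) (hY x)
  rw [contMDiffAt_totalSpace] at this
  exact this.2

theorem contMDiff_mvfderiv_apply {f : M → ℝ} (hf : ContMDiff 𝓘(ℝ, E) 𝓘(ℝ, ℝ) ∞ f)
    (hX : IsSmoothField X) :
    ContMDiff 𝓘(ℝ, E) 𝓘(ℝ, ℝ) ∞ (fun y => mvfderiv 𝓘(ℝ, E) f y (X y)) := by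
  -- `df(X)` is the fibre component of the tangent map of `f` composed with the section `X`.
  have h := (hf.contMDiff_tangentMap (m := ∞) (n := ∞) (by simp)).comp hX
  intro x
  have := h x
  rw [contMDiffAt_totalSpace] at this
  convert this.2 using 1
  ext y
  simp [tangentMap, mvfderiv]
  rfl

theorem IsSmoothField.mlieBracket [FiniteDimensional ℝ E] (hX : IsSmoothField X)
    (hY : IsSmoothField Y) :
    IsSmoothField (mlieBracket 𝓘(ℝ, E) X Y) := by
  have : IsManifold 𝓘(ℝ, E) ((⊤ : ℕ∞) + 1) M := inferInstanceAs (IsManifold 𝓘(ℝ, E) ∞ M)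
  have : IsManifold 𝓘(ℝ, E) (minSmoothness ℝ 2) M :=
    IsManifold.of_le (n := ∞) (by simpa using WithTop.coe_le_coe.2 (le_top : (2 : ℕ∞) ≤ ⊤))
  have := FiniteDimensional.complete ℝ E
  exact ContDiff.mlieBracket_vectorField (m := ⊤) (n := ⊤) hX hY (by simp)

variable [FiniteDimensional ℝ E] [T2Space M]

/-- A vector field that is smooth near `x` has the germ at `x` of a global smooth vector field. -/
theorem exists_isSmoothField_eventuallyEq {s : ∀ x : M, TangentSpace 𝓘(ℝ, E) x} {u : Set M}
    {x : M} (hu : IsOpen u) (hx : x ∈ u) (hs : CMDiff[u] ∞ (T% s)) :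
    ∃ X : ∀ x : M, TangentSpace 𝓘(ℝ, E) x, IsSmoothField X ∧ ∀ᶠ y in 𝓝 x, X y = s y := by
  obtain ⟨f, -, hf⟩ := (SmoothBumpFunction.nhds_basis_tsupport (I := 𝓘(ℝ, E)) x).mem_iff.1
    (hu.mem_nhds hx)
  refine ⟨(f : M → ℝ) • s,
    ContMDiffOn.smul_section_of_tsupport f.contMDiff.contMDiffOn hu hf hs, ?_⟩
  filter_upwards [f.eventuallyEq_one] with y hy
  simp [hy]

theorem exists_isSmoothField_apply_eq (x : M) (v : TangentSpace 𝓘(ℝ, E) x) :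
    ∃ X : ∀ x : M, TangentSpace 𝓘(ℝ, E) x, IsSmoothField X ∧ X x = v := by
  obtain ⟨u, hu, hs⟩ := FiberBundle.exists_contMDiffOn_extend (k := ∞) 𝓘(ℝ, E) E v
  obtain ⟨X, hX, hXs⟩ := exists_isSmoothField_eventuallyEq isOpen_interior
    (mem_interior_iff_mem_nhds.2 hu) (hs.mono interior_subset)
  exact ⟨X, hX, by simpa using hXs.self_of_nhds⟩

end SmoothFields

/-! ### Smoothness of the Levi-Civita connection. -/

section LeviCivitaSmooth

variable {E : Type*} [NormedAddCommGroup E] [NormedSpace ℝ E]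
  {M : Type*} [TopologicalSpace M] [ChartedSpace E M]

theorem contMDiffAt_det {n : Type*} [Fintype n] [DecidableEq n] {A : M → Matrix n n ℝ} {x : M}
    (hA : ∀ i j, ContMDiffAt 𝓘(ℝ, E) 𝓘(ℝ, ℝ) ∞ (fun y => A y i j) x) :
    ContMDiffAt 𝓘(ℝ, E) 𝓘(ℝ, ℝ) ∞ (fun y => (A y).det) x := by
  simp only [Matrix.det_apply']
  refine contMDiffAt_finsetSum fun σ _ => ?_
  exact contMDiffAt_const.mul (contMDiffAt_finsetProd fun i _ => hA _ _)

/-- Solutions of smooth families of invertible linear systems are smooth. -/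
theorem contMDiffAt_of_vecMul {n : Type*} [Fintype n] [DecidableEq n] {A : M → Matrix n n ℝ}
    {c : M → n → ℝ} {x : M}
    (hA : ∀ i j, ContMDiffAt 𝓘(ℝ, E) 𝓘(ℝ, ℝ) ∞ (fun y => A y i j) x)
    (hdet : ∀ᶠ y in 𝓝 x, (A y).det ≠ 0)
    (hc : ∀ j, ContMDiffAt 𝓘(ℝ, E) 𝓘(ℝ, ℝ) ∞ (fun y => (A y).vecMul (c y) j) x) (i : n) :
    ContMDiffAt 𝓘(ℝ, E) 𝓘(ℝ, ℝ) ∞ (fun y => c y i) x := by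
  -- Cramer's rule: replacing row `i` of `A` by `c A` multiplies the determinant by `c i`.
  have hB : ContMDiffAt 𝓘(ℝ, E) 𝓘(ℝ, ℝ) ∞
      (fun y => ((A y).updateRow i (Matrix.vecMul (c y) (A y))).det) x := by
    refine contMDiffAt_det fun k l => ?_
    by_cases h : k = i
    · subst h; simpa using hc l
    · simpa [Matrix.updateRow_ne h] using hA k l
  have hI : ContMDiffAt 𝓘(ℝ, E) 𝓘(ℝ, ℝ) ∞ (fun y => ((A y).det)⁻¹) x :=
    (contMDiffAt_det hA).inv₀ hdet.self_of_nhds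
  refine (hI.mul hB).congr_of_eventuallyEq ?_
  filter_upwards [hdet] with y hy
  have : ((A y).updateRow i (Matrix.vecMul (c y) (A y))).det = c y i * (A y).det := by
    have := Matrix.det_updateRow_sum (A y) i (c y)
    rw [← smul_eq_mul, ← this]
    congr 2
    ext j
    simp [Matrix.vecMul, dotProduct]
  rw [Pi.mul_apply, this]
  field_simp

variable [IsManifold 𝓘(ℝ, E) ∞ M] [FiniteDimensional ℝ E]

theorem IsLeviCivita.mlieBracket_eq
    {g : ∀ x : M, TangentSpace 𝓘(ℝ, E) x →L[ℝ] TangentSpace 𝓘(ℝ, E) x →L[ℝ] ℝ}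
    {D : CovariantDerivative 𝓘(ℝ, E) E (fun x : M => TangentSpace 𝓘(ℝ, E) x)}
    (hD : IsLeviCivita g D) {X Y : ∀ x : M, TangentSpace 𝓘(ℝ, E) x} {x : M}
    (hX : MDiffAt (T% X) x) (hY : MDiffAt (T% Y) x) :
    mlieBracket 𝓘(ℝ, E) X Y x = D Y x (X x) - D X x (Y x) :=
  (D.torsion_eq_zero_iff.1 hD.torsion_eq_zero hX hY).symm

/-- The uniqueness half of the fundamental theorem: metric compatibility and vanishing torsion
determine `∇`. -/
theorem IsLeviCivita.two_mul_inner_eq_koszul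
    {g : ∀ x : M, TangentSpace 𝓘(ℝ, E) x →L[ℝ] TangentSpace 𝓘(ℝ, E) x →L[ℝ] ℝ}
    {D : CovariantDerivative 𝓘(ℝ, E) E (fun x : M => TangentSpace 𝓘(ℝ, E) x)}
    (hD : IsLeviCivita g D) (hs : ∀ x v w, g x v w = g x w v)
    {X Y Z : ∀ x : M, TangentSpace 𝓘(ℝ, E) x} {x : M} (hX : MDiffAt (T% X) x)
    (hY : MDiffAt (T% Y) x) (hZ : MDiffAt (T% Z) x) :
    2 * g x (D Y x (X x)) (Z x) = koszul g Y X Z x := by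
  simp only [koszul, hD.metric _ _ x hY hZ, hD.metric _ _ x hX hZ, hD.metric _ _ x hX hY,
    hD.mlieBracket_eq hX hY, hD.mlieBracket_eq hX hZ, hD.mlieBracket_eq hY hZ]
  simp only [map_sub, sub_apply]
  rw [hs x (Y x), hs x (X x) (D Z x _), hs x (X x) (D Y x _)]
  ring

variable [T2Space M]
  {g : ∀ x : M, TangentSpace 𝓘(ℝ, E) x →L[ℝ] TangentSpace 𝓘(ℝ, E) x →L[ℝ] ℝ}

/-- In a local frame, the coefficients of `U` solve a linear system with the Gram matrix of `g` as
its matrix and the smooth functions `g(U, s j)` on the right. Positivity makes the matrix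
invertible, and Cramer's rule applies. -/
theorem isSmoothField_of_inner (hp : ∀ x v, v ≠ 0 → 0 < g x v v)
    (hg : ∀ X Y, IsSmoothField X → IsSmoothField Y →
      ContMDiff 𝓘(ℝ, E) 𝓘(ℝ, ℝ) ∞ (fun y => g y (X y) (Y y)))
    {U : ∀ x : M, TangentSpace 𝓘(ℝ, E) x}
    (hU : ∀ Z, IsSmoothField Z → ContMDiff 𝓘(ℝ, E) 𝓘(ℝ, ℝ) ∞ (fun y => g y (U y) (Z y))) :
    IsSmoothField U := by
  intro x
  let e := trivializationAt E (TangentSpace 𝓘(ℝ, E)) x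
  have hx : x ∈ e.baseSet := FiberBundle.mem_baseSet_trivializationAt' x
  let b := Module.finBasis ℝ E
  have hloc := e.isLocalFrameOn_localFrame_baseSet 𝓘(ℝ, E) ∞ b
  -- The hypotheses concern global fields only, so the frame is replaced by global fields with the
  -- same germs at `x`.
  choose s hs hsx using fun i => exists_isSmoothField_eventuallyEq e.open_baseSet hx
    (hloc.contMDiffOn i)
  have hsx' := Filter.eventually_all.2 hsx
  refine hloc.contMDiffAt_of_coeff_aux (fun i => ?_) e.open_baseSet hx
  have key : ∀ y ∈ e.baseSet, (∀ i, s i y = e.localFrame b i y) →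
      U y = ∑ i, hloc.coeff i y (U y) • s i y := by
    intro y hy h
    simp only [h]
    exact hloc.coeff_sum_eq U hy
  refine contMDiffAt_of_vecMul (A := fun y => Matrix.of fun i j => g y (s i y) (s j y))
    (c := fun y i => hloc.coeff i y (U y)) (fun i j => ?_) ?_ (fun j => ?_) i
  · exact hg _ _ (hs i) (hs j) x
  · filter_upwards [hsx', e.open_baseSet.mem_nhds hx] with y hy hye
    -- A vector in the left kernel of the Gram matrix gives `w = ∑ v i • s i ≠ 0` orthogonal to the
    -- frame, hence `g(w,w) = 0`.
    rw [← Matrix.det_transpose]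
    intro h0
    obtain ⟨v, hv, hv0⟩ := Matrix.exists_mulVec_eq_zero_iff.2 h0
    have hne : ∑ i, v i • s i y ≠ 0 := by
      intro h
      simp only [hy] at h
      exact hv (funext (Fintype.linearIndependent_iff.1 (hloc.linearIndependent hye) v h))
    refine (hp y _ hne).ne' ?_
    have : ∀ j, g y (∑ i, v i • s i y) (s j y) = 0 := by
      intro j
      have := congrFun hv0 j
      simpa [Matrix.mulVec, dotProduct, mul_comm] using this
    refine (map_sum (g y (∑ i, v i • s i y)) _ _).trans (Finset.sum_eq_zero fun j _ => ?_)
    rw [map_smul, this, smul_zero]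
  · refine (hU _ (hs j) x).congr_of_eventuallyEq ?_
    filter_upwards [hsx', e.open_baseSet.mem_nhds hx] with y hy hye
    conv_rhs => rw [key y hye hy]
    simp [Matrix.vecMul, dotProduct]

/-- `IsLeviCivita` does not include smoothness of `∇_X Y`; it is recovered because the Koszul
expression is smooth for every smooth `Z`. -/
theorem IsLeviCivita.isSmoothField_nabla
    {D : CovariantDerivative 𝓘(ℝ, E) E (fun x : M => TangentSpace 𝓘(ℝ, E) x)}
    (hD : IsLeviCivita g D) (hs : ∀ x v w, g x v w = g x w v) (hp : ∀ x v, v ≠ 0 → 0 < g x v v)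
    (hg : ∀ X Y, IsSmoothField X → IsSmoothField Y →
      ContMDiff 𝓘(ℝ, E) 𝓘(ℝ, ℝ) ∞ (fun y => g y (X y) (Y y)))
    {X Y : ∀ x : M, TangentSpace 𝓘(ℝ, E) x} (hX : IsSmoothField X) (hY : IsSmoothField Y) :
    IsSmoothField (nabla D X Y) := by
  refine isSmoothField_of_inner hp hg fun Z hZ => ?_
  have e : (fun y => g y (nabla D X Y y) (Z y)) = fun y => 2⁻¹ * koszul g Y X Z y := by
    ext y
    rw [← hD.two_mul_inner_eq_koszul hs (hX.mdifferentiableAt y) (hY.mdifferentiableAt y)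
      (hZ.mdifferentiableAt y)]
    simp [nabla]
  rw [e]
  refine contMDiff_const.mul ?_
  unfold koszul
  exact (((((contMDiff_mvfderiv_apply (hg _ _ hY hZ) hX).add
    (contMDiff_mvfderiv_apply (hg _ _ hX hZ) hY)).sub
    (contMDiff_mvfderiv_apply (hg _ _ hX hY) hZ)).add
    (hg _ _ (hX.mlieBracket hY) hZ)).sub (hg _ _ (hX.mlieBracket hZ) hY)).sub
    (hg _ _ (hY.mlieBracket hZ) hX)

end LeviCivitaSmooth

/-! ### Pointwise algebra of `κ`, `J` and `g_J`. -/

section Endomorphism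

variable {E : Type*} [NormedAddCommGroup E] [NormedSpace ℝ E]
  {M : Type*} [TopologicalSpace M] [ChartedSpace E M]
  {κ : ∀ x : M, TangentSpace 𝓘(ℝ, E) x →L[ℝ] TangentSpace 𝓘(ℝ, E) x →L[ℝ] ℝ}
  {J : ∀ x : M, TangentSpace 𝓘(ℝ, E) x →L[ℝ] TangentSpace 𝓘(ℝ, E) x}

theorem applyJ_add (X Y : ∀ x : M, TangentSpace 𝓘(ℝ, E) x) :
    applyJ J (X + Y) = applyJ J X + applyJ J Y :=
  funext fun _ => map_add _ _ _

theorem applyJ_sub (X Y : ∀ x : M, TangentSpace 𝓘(ℝ, E) x) :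
    applyJ J (X - Y) = applyJ J X - applyJ J Y :=
  funext fun _ => map_sub _ _ _

theorem applyJ_neg (X : ∀ x : M, TangentSpace 𝓘(ℝ, E) x) : applyJ J (-X) = -applyJ J X :=
  funext fun _ => map_neg _ _

theorem applyJ_smul (c : ℝ) (X : ∀ x : M, TangentSpace 𝓘(ℝ, E) x) :
    applyJ J (c • X) = c • applyJ J X :=
  funext fun _ => map_smul _ _ _

theorem applyJ_zero : applyJ J (0 : ∀ x : M, TangentSpace 𝓘(ℝ, E) x) = 0 :=
  funext fun _ => map_zero _

variable [IsManifold 𝓘(ℝ, E) ∞ M]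

theorem IsCalibrated.applyJ_applyJ (hJ : IsCalibrated κ J) (X : ∀ x : M, TangentSpace 𝓘(ℝ, E) x) :
    applyJ J (applyJ J X) = -X :=
  funext fun x => hJ.sq x (X x)

theorem IsSymplectic.antisymm (hκ : IsSymplectic κ) (x : M) (v w : TangentSpace 𝓘(ℝ, E) x) :
    κ x v w = -κ x w v := by
  have h := hκ.alternating x (v + w)
  simp only [map_add, add_apply, hκ.alternating] at h
  linarith

theorem calibratedMetric_symm (hκ : IsSymplectic κ) (hJ : IsCalibrated κ J) (x : M)
    (v w : TangentSpace 𝓘(ℝ, E) x) :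
    calibratedMetric κ J x v w = calibratedMetric κ J x w v := by
  have h := hJ.invariant x v (J x w)
  rw [hJ.sq, map_neg] at h
  change κ x (J x v) w = κ x (J x w) v
  rw [hκ.antisymm x (J x w), ← h, neg_neg]

theorem calibratedMetric_applyJ_left (hκ : IsSymplectic κ) (hJ : IsCalibrated κ J) (x : M)
    (v w : TangentSpace 𝓘(ℝ, E) x) :
    calibratedMetric κ J x (J x v) w = -calibratedMetric κ J x v (J x w) := by
  rw [calibratedMetric_symm hκ hJ x v]
  change κ x (J x (J x v)) w = -κ x (J x (J x w)) v
  rw [hJ.sq, hJ.sq, hκ.antisymm]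
  simp

theorem IsCalibrated.eq_neg_calibratedMetric (hJ : IsCalibrated κ J) (x : M)
    (v w : TangentSpace 𝓘(ℝ, E) x) :
    κ x v w = -calibratedMetric κ J x (J x v) w := by
  change κ x v w = -κ x (J x (J x v)) w
  simp [hJ.sq]

theorem contMDiff_calibratedMetric (hκ : IsSymplectic κ) (hJ : IsCalibrated κ J)
    (X Y : ∀ x : M, TangentSpace 𝓘(ℝ, E) x) (hX : IsSmoothField X) (hY : IsSmoothField Y) :
    ContMDiff 𝓘(ℝ, E) 𝓘(ℝ, ℝ) ∞ (fun y => calibratedMetric κ J y (X y) (Y y)) :=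
  hκ.contMDiff_apply (hX.applyJ hJ) hY

end Endomorphism

/-! ### Algebraic properties of `∇J`. -/

section Nabla

variable {E : Type*} [NormedAddCommGroup E] [NormedSpace ℝ E]
  {M : Type*} [TopologicalSpace M] [ChartedSpace E M] [IsManifold 𝓘(ℝ, E) ∞ M]
  (D : CovariantDerivative 𝓘(ℝ, E) E (fun x : M => TangentSpace 𝓘(ℝ, E) x))
  {κ : ∀ x : M, TangentSpace 𝓘(ℝ, E) x →L[ℝ] TangentSpace 𝓘(ℝ, E) x →L[ℝ] ℝ}
  {J : ∀ x : M, TangentSpace 𝓘(ℝ, E) x →L[ℝ] TangentSpace 𝓘(ℝ, E) x}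

theorem nabla_smul_right (X : ∀ x : M, TangentSpace 𝓘(ℝ, E) x) (c : ℝ)
    {Y : ∀ x : M, TangentSpace 𝓘(ℝ, E) x} (hY : IsSmoothField Y) :
    nabla D X (c • Y) = c • nabla D X Y := by
  ext x
  simp [nabla, D.isCovariantDerivativeOnUniv.smul_const c (hY.mdifferentiableAt x)]

theorem nabla_neg_right (X : ∀ x : M, TangentSpace 𝓘(ℝ, E) x)
    {Y : ∀ x : M, TangentSpace 𝓘(ℝ, E) x} (hY : IsSmoothField Y) :
    nabla D X (-Y) = -nabla D X Y := by
  simpa using nabla_smul_right D X (-1) hY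

theorem nablaJ_smul_right (hJ : IsCalibrated κ J) (X : ∀ x : M, TangentSpace 𝓘(ℝ, E) x) (c : ℝ)
    {Y : ∀ x : M, TangentSpace 𝓘(ℝ, E) x} (hY : IsSmoothField Y) :
    nablaJ D J X (c • Y) = c • nablaJ D J X Y := by
  simp only [nablaJ, applyJ_smul, nabla_smul_right D X c hY, nabla_smul_right D X c (hY.applyJ hJ)]
  module

theorem nablaJ_neg_right (hJ : IsCalibrated κ J) (X : ∀ x : M, TangentSpace 𝓘(ℝ, E) x)
    {Y : ∀ x : M, TangentSpace 𝓘(ℝ, E) x} (hY : IsSmoothField Y) :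
    nablaJ D J X (-Y) = -nablaJ D J X Y := by
  simpa using nablaJ_smul_right D hJ X (-1) hY

theorem nablaJ_neg_left (X Y : ∀ x : M, TangentSpace 𝓘(ℝ, E) x) :
    nablaJ D J (-X) Y = -nablaJ D J X Y := by
  ext x
  simp [nablaJ, nabla, applyJ]
  abel

/-- `∇_X J` anticommutes with `J`. -/
theorem nablaJ_applyJ_right (hJ : IsCalibrated κ J) (X : ∀ x : M, TangentSpace 𝓘(ℝ, E) x)
    {Y : ∀ x : M, TangentSpace 𝓘(ℝ, E) x} (hY : IsSmoothField Y) :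
    nablaJ D J X (applyJ J Y) = -applyJ J (nablaJ D J X Y) := by
  simp only [nablaJ, applyJ_sub, hJ.applyJ_applyJ, nabla_neg_right D X hY]
  abel

end Nabla

/-! ### Closedness of `κ` and the quasi-Kähler identity. -/

section Calibrated

variable {E : Type*} [NormedAddCommGroup E] [NormedSpace ℝ E] [FiniteDimensional ℝ E]
  {M : Type*} [TopologicalSpace M] [ChartedSpace E M] [IsManifold 𝓘(ℝ, E) ∞ M]
  {D : CovariantDerivative 𝓘(ℝ, E) E (fun x : M => TangentSpace 𝓘(ℝ, E) x)}
  {κ : ∀ x : M, TangentSpace 𝓘(ℝ, E) x →L[ℝ] TangentSpace 𝓘(ℝ, E) x →L[ℝ] ℝ}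
  {J : ∀ x : M, TangentSpace 𝓘(ℝ, E) x →L[ℝ] TangentSpace 𝓘(ℝ, E) x}
  {X Y Z : ∀ x : M, TangentSpace 𝓘(ℝ, E) x}

/-- `∇_X J` is skew-adjoint. -/
theorem calibratedMetric_nablaJ_left (hκ : IsSymplectic κ) (hJ : IsCalibrated κ J)
    (hD : IsLeviCivita (calibratedMetric κ J) D) (hY : IsSmoothField Y) (hZ : IsSmoothField Z)
    (x : M) :
    calibratedMetric κ J x (nablaJ D J X Y x) (Z x) =
      -calibratedMetric κ J x (Y x) (nablaJ D J X Z x) := by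
  have h1 := hD.metric _ _ x ((hY.applyJ hJ).mdifferentiableAt x) (hZ.mdifferentiableAt x) (X x)
  have h2 := hD.metric _ _ x (hY.mdifferentiableAt x) ((hZ.applyJ hJ).mdifferentiableAt x) (X x)
  have e : (fun y => calibratedMetric κ J y (applyJ J Y y) (Z y)) =
      -fun y => calibratedMetric κ J y (Y y) (applyJ J Z y) :=
    funext fun y => calibratedMetric_applyJ_left hκ hJ y _ _
  rw [e, mvfderiv_neg] at h1
  have h3 := calibratedMetric_applyJ_left hκ hJ x (D Y x (X x)) (Z x)
  have h4 := calibratedMetric_applyJ_left hκ hJ x (Y x) (D Z x (X x))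
  simp only [nablaJ, nabla, applyJ, Pi.sub_apply, map_sub, sub_apply, neg_apply] at *
  linarith

/-- Since `κ(Y,Z) = -g(JY,Z)` and `g` is parallel, `(∇_X κ)(Y,Z) = -g((∇_X J)Y, Z)`. -/
theorem mvfderiv_form_eq (hJ : IsCalibrated κ J)
    (hD : IsLeviCivita (calibratedMetric κ J) D) (hY : IsSmoothField Y) (hZ : IsSmoothField Z)
    (x : M) :
    mvfderiv 𝓘(ℝ, E) (fun y => κ y (Y y) (Z y)) x (X x) =
      -calibratedMetric κ J x (nablaJ D J X Y x) (Z x) + κ x (D Y x (X x)) (Z x)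
        + κ x (Y x) (D Z x (X x)) := by
  have h1 := hD.metric _ _ x ((hY.applyJ hJ).mdifferentiableAt x) (hZ.mdifferentiableAt x) (X x)
  have e : (fun y => calibratedMetric κ J y (applyJ J Y y) (Z y)) = -fun y => κ y (Y y) (Z y) :=
    funext fun y => by
      rw [Pi.neg_apply, hJ.eq_neg_calibratedMetric, neg_neg]
      rfl
  rw [e, mvfderiv_neg] at h1
  rw [hJ.eq_neg_calibratedMetric x (D Y x (X x)), hJ.eq_neg_calibratedMetric x (Y x)]
  simp only [nablaJ, nabla, applyJ, Pi.sub_apply, map_sub, sub_apply, neg_apply] at *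
  linarith

/-- Closedness of `κ` in terms of `∇J`. -/
theorem calibratedMetric_nablaJ_cyclic (hκ : IsSymplectic κ) (hJ : IsCalibrated κ J)
    (hD : IsLeviCivita (calibratedMetric κ J) D) (hX : IsSmoothField X) (hY : IsSmoothField Y)
    (hZ : IsSmoothField Z) (x : M) :
    calibratedMetric κ J x (nablaJ D J X Y x) (Z x)
      + calibratedMetric κ J x (nablaJ D J Y Z x) (X x)
      + calibratedMetric κ J x (nablaJ D J Z X x) (Y x) = 0 := by
  have h := congrFun (hκ.closed X Y Z hX hY hZ) x
  -- The `Y`-derivative enters `dκ` with the order `X`, `Z`; skew-adjointness turns it into the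
  -- cyclic order.
  have e1 := calibratedMetric_nablaJ_left (X := Y) hκ hJ hD hX hZ x
  rw [calibratedMetric_symm hκ hJ x (X x)] at e1
  simp only [extDerivTwoForm, mvfderiv_form_eq (X := X) hJ hD hY hZ,
    mvfderiv_form_eq (X := Y) hJ hD hX hZ, mvfderiv_form_eq (X := Z) hJ hD hX hY,
    hD.mlieBracket_eq (hX.mdifferentiableAt x) (hY.mdifferentiableAt x),
    hD.mlieBracket_eq (hX.mdifferentiableAt x) (hZ.mdifferentiableAt x),
    hD.mlieBracket_eq (hY.mdifferentiableAt x) (hZ.mdifferentiableAt x), map_sub, sub_apply,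
    Pi.zero_apply] at h
  rw [hκ.antisymm x (Y x) (D Z x _), hκ.antisymm x (X x) (D Z x _),
    hκ.antisymm x (X x) (D Y x _)] at h
  linarith

variable [T2Space M]

theorem ext_calibratedMetric (hJ : IsCalibrated κ J)
    {U V : ∀ x : M, TangentSpace 𝓘(ℝ, E) x}
    (h : ∀ Z, IsSmoothField Z → ∀ x,
      calibratedMetric κ J x (U x) (Z x) = calibratedMetric κ J x (V x) (Z x)) : U = V := by
  ext x
  by_contra hne
  obtain ⟨Z, hZ, hZx⟩ := exists_isSmoothField_apply_eq x (U x - V x)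
  have h1 := h Z hZ x
  have h2 : 0 < calibratedMetric κ J x (U x - V x) (U x - V x) :=
    hJ.pos x _ (sub_ne_zero.2 hne)
  rw [hZx] at h1
  rw [map_sub (calibratedMetric κ J x), sub_apply, h1, sub_self] at h2
  exact h2.false

/-- The quasi-Kähler identity. -/
theorem nablaJ_applyJ_left (hκ : IsSymplectic κ) (hJ : IsCalibrated κ J)
    (hD : IsLeviCivita (calibratedMetric κ J) D) (hX : IsSmoothField X) (hY : IsSmoothField Y) :
    nablaJ D J (applyJ J X) Y = -applyJ J (nablaJ D J X Y) := by
  rw [← nablaJ_applyJ_right D hJ X hY]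
  refine ext_calibratedMetric hJ fun Z hZ x => ?_
  have hX' := hX.applyJ hJ
  have hY' := hY.applyJ hJ
  have hZ' := hZ.applyJ hJ
  have hT : ∀ {A B C : ∀ x : M, TangentSpace 𝓘(ℝ, E) x}, IsSmoothField B →
      calibratedMetric κ J x (nablaJ D J A (applyJ J B) x) (C x) =
        calibratedMetric κ J x (nablaJ D J A B x) (applyJ J C x) := by
    intro A B C hB
    have := calibratedMetric_applyJ_left hκ hJ x (nablaJ D J A B x) (C x)
    rw [nablaJ_applyJ_right D hJ A hB, Pi.neg_apply, map_neg, neg_apply]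
    simp only [applyJ] at *
    linarith
  have hTT : ∀ {A B C : ∀ x : M, TangentSpace 𝓘(ℝ, E) x}, IsSmoothField B →
      calibratedMetric κ J x (nablaJ D J A (applyJ J B) x) (applyJ J C x) =
        -calibratedMetric κ J x (nablaJ D J A B x) (C x) := by
    intro A B C hB
    rw [hT hB, hJ.applyJ_applyJ]
    simp
  -- With `T(X,Y,Z) = g(A_X Y, Z)`, moving `J` between the last two slots costs nothing and `J` in
  -- both gives a sign. Then `s1 + s2 - s3` with the sign-reversed `s4` leaves `2 T(X,Y,JZ) = 2
  -- T(JX,Y,Z)`.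
  have s1 := calibratedMetric_nablaJ_cyclic hκ hJ hD hX hY' hZ x
  have s2 := calibratedMetric_nablaJ_cyclic hκ hJ hD hX hY hZ' x
  have s3 := calibratedMetric_nablaJ_cyclic hκ hJ hD hX' hY hZ x
  have s4 := calibratedMetric_nablaJ_cyclic hκ hJ hD hX' hY' hZ' x
  simp only [hTT hX, hTT hY, hTT hZ, hT hX, hT hY, hT hZ] at *
  linarith

end Calibrated

/-! ### Complex fields of type (1,0) as test arguments. -/

section OneZero

variable {E : Type*} [NormedAddCommGroup E] [NormedSpace ℝ E]
  {M : Type*} [TopologicalSpace M] [ChartedSpace E M]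
  {κ : ∀ x : M, TangentSpace 𝓘(ℝ, E) x →L[ℝ] TangentSpace 𝓘(ℝ, E) x →L[ℝ] ℝ}
  {J : ∀ x : M, TangentSpace 𝓘(ℝ, E) x →L[ℝ] TangentSpace 𝓘(ℝ, E) x}
  {X Y : ∀ x : M, TangentSpace 𝓘(ℝ, E) x}

/-- The complex vector field `X - iJX` of type `(1,0)`. -/
noncomputable def oneZeroField (J : ∀ x : M, TangentSpace 𝓘(ℝ, E) x →L[ℝ] TangentSpace 𝓘(ℝ, E) x)
    (X : ∀ x : M, TangentSpace 𝓘(ℝ, E) x) : ComplexField E M :=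
  (X, -applyJ J X)

theorem zeroOnePart_two_smul (P : ∀ x : M, TangentSpace 𝓘(ℝ, E) x) :
    ComplexField.zeroOnePart J (((2 : ℝ) • P, 0) : ComplexField E M) = (P, applyJ J P) := by
  simp [ComplexField.zeroOnePart, ComplexField.applyJ, ComplexField.mulI, applyJ_smul, applyJ_zero]

variable [IsManifold 𝓘(ℝ, E) ∞ M]

theorem isTypeOneZero_oneZeroField (hJ : IsCalibrated κ J) (X : ∀ x : M, TangentSpace 𝓘(ℝ, E) x) :
    (oneZeroField J X).IsTypeOneZero J := by
  simp [ComplexField.IsTypeOneZero, ComplexField.applyJ, ComplexField.mulI, oneZeroField,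
    applyJ_neg, hJ.applyJ_applyJ]

theorem isSmooth_oneZeroField (hJ : IsCalibrated κ J) (hX : IsSmoothField X) :
    (oneZeroField J X).IsSmooth :=
  ⟨hX, (hX.applyJ hJ).neg⟩

variable {D : CovariantDerivative 𝓘(ℝ, E) E (fun x : M => TangentSpace 𝓘(ℝ, E) x)}

theorem tensorB_neg_left (X Y : ∀ x : M, TangentSpace 𝓘(ℝ, E) x) :
    tensorB D J (-X) Y = -tensorB D J X Y := by
  simp only [tensorB, applyJ_neg, nablaJ_neg_left]
  abel

theorem tensorB_neg_right (hJ : IsCalibrated κ J) (X : ∀ x : M, TangentSpace 𝓘(ℝ, E) x)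
    (hY : IsSmoothField Y) : tensorB D J X (-Y) = -tensorB D J X Y := by
  simp only [tensorB, applyJ_neg, nablaJ_neg_right D hJ _ hY]
  abel

end OneZero

/-! ### Type decomposition of `∇''B` and vanishing of `∇J`. -/

section Rigidity

variable {E : Type*} [NormedAddCommGroup E] [NormedSpace ℝ E] [FiniteDimensional ℝ E]
  {M : Type*} [TopologicalSpace M] [ChartedSpace E M] [IsManifold 𝓘(ℝ, E) ∞ M]
  {D : CovariantDerivative 𝓘(ℝ, E) E (fun x : M => TangentSpace 𝓘(ℝ, E) x)}
  {κ : ∀ x : M, TangentSpace 𝓘(ℝ, E) x →L[ℝ] TangentSpace 𝓘(ℝ, E) x →L[ℝ] ℝ}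
  {J : ∀ x : M, TangentSpace 𝓘(ℝ, E) x →L[ℝ] TangentSpace 𝓘(ℝ, E) x}
  {X Y : ∀ x : M, TangentSpace 𝓘(ℝ, E) x}

/-- An almost complex structure that is parallel for a torsion-free connection is integrable. -/
theorem nijenhuis_eq_zero_of_nablaJ_eq_zero (hJ : IsCalibrated κ J)
    {g : ∀ x : M, TangentSpace 𝓘(ℝ, E) x →L[ℝ] TangentSpace 𝓘(ℝ, E) x →L[ℝ] ℝ}
    (hD : IsLeviCivita g D)
    (hA : ∀ X Y, IsSmoothField X → IsSmoothField Y → nablaJ D J X Y = 0)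
    (hX : IsSmoothField X) (hY : IsSmoothField Y) : nijenhuis J X Y = 0 := by
  have hbr : ∀ {X Y}, IsSmoothField X → IsSmoothField Y →
      mlieBracket 𝓘(ℝ, E) X Y = nabla D X Y - nabla D Y X := fun hX hY =>
    funext fun x => hD.mlieBracket_eq (hX.mdifferentiableAt x) (hY.mdifferentiableAt x)
  have hc : ∀ {X Y}, IsSmoothField X → IsSmoothField Y →
      nabla D X (applyJ J Y) = applyJ J (nabla D X Y) := fun hX hY => sub_eq_zero.1 (hA _ _ hX hY)
  have hX' := hX.applyJ hJ
  have hY' := hY.applyJ hJ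
  -- Once the brackets are written through `∇` and `J` is moved outside, the terms cancel in pairs.
  simp only [nijenhuis, hbr hX hY, hbr hX' hY, hbr hX hY', hbr hX' hY', hc hX hY, hc hX' hY,
    hc hY hX, hc hY' hX, applyJ_sub, hJ.applyJ_applyJ]
  abel

variable [T2Space M]

theorem IsSmoothField.nabla (hκ : IsSymplectic κ) (hJ : IsCalibrated κ J)
    (hD : IsLeviCivita (calibratedMetric κ J) D) (hX : IsSmoothField X) (hY : IsSmoothField Y) :
    IsSmoothField (nabla D X Y) :=
  hD.isSmoothField_nabla (calibratedMetric_symm hκ hJ) hJ.pos (contMDiff_calibratedMetric hκ hJ)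
    hX hY

theorem IsSmoothField.nablaJ (hκ : IsSymplectic κ) (hJ : IsCalibrated κ J)
    (hD : IsLeviCivita (calibratedMetric κ J) D) (hX : IsSmoothField X) (hY : IsSmoothField Y) :
    IsSmoothField (nablaJ D J X Y) :=
  (hX.nabla hκ hJ hD (hY.applyJ hJ)).sub ((hX.nabla hκ hJ hD hY).applyJ hJ)

/-- By the quasi-Kähler identity the two terms of `B` coincide, so `B` carries the same information
as `∇J`. -/
theorem tensorB_eq (hκ : IsSymplectic κ) (hJ : IsCalibrated κ J)
    (hD : IsLeviCivita (calibratedMetric κ J) D) (hX : IsSmoothField X) (hY : IsSmoothField Y) :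
    tensorB D J X Y = (2 : ℝ) • applyJ J (nablaJ D J X Y) := by
  rw [tensorB, nablaJ_applyJ_left hκ hJ hD hX hY]
  module

theorem tensorB_applyJ_left (hκ : IsSymplectic κ) (hJ : IsCalibrated κ J)
    (hD : IsLeviCivita (calibratedMetric κ J) D) (hX : IsSmoothField X) (hY : IsSmoothField Y) :
    tensorB D J (applyJ J X) Y = -applyJ J (tensorB D J X Y) := by
  rw [tensorB_eq hκ hJ hD (hX.applyJ hJ) hY, tensorB_eq hκ hJ hD hX hY,
    nablaJ_applyJ_left hκ hJ hD hX hY, applyJ_smul, applyJ_neg]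
  module

theorem tensorB_applyJ_right (hκ : IsSymplectic κ) (hJ : IsCalibrated κ J)
    (hD : IsLeviCivita (calibratedMetric κ J) D) (hX : IsSmoothField X) (hY : IsSmoothField Y) :
    tensorB D J X (applyJ J Y) = -applyJ J (tensorB D J X Y) := by
  rw [tensorB_eq hκ hJ hD hX (hY.applyJ hJ), tensorB_eq hκ hJ hD hX hY,
    nablaJ_applyJ_right D hJ X hY, applyJ_smul, applyJ_neg]
  module

/-- A pair `(U, JU)` stands for `U + iJU`, so the equation says type (0,1). From `B(JW,H) = -J
B(W,H)` and `JW = iW` one gets `J B(W,H) = -i B(W,H)`, whatever the type of `H`. -/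
theorem complexify_tensorB_oneZeroField_left (hκ : IsSymplectic κ) (hJ : IsCalibrated κ J)
    (hD : IsLeviCivita (calibratedMetric κ J) D) (hX : IsSmoothField X) {W : ComplexField E M}
    (hW : W.IsSmooth) :
    (complexify₂ (tensorB D J) (oneZeroField J X) W).2 =
      applyJ J (complexify₂ (tensorB D J) (oneZeroField J X) W).1 := by
  simp only [complexify₂, oneZeroField, tensorB_neg_left, tensorB_applyJ_left hκ hJ hD hX hW.1,
    tensorB_applyJ_left hκ hJ hD hX hW.2, applyJ_sub, applyJ_neg, hJ.applyJ_applyJ]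
  abel

theorem complexify_tensorB_oneZeroField_right (hκ : IsSymplectic κ) (hJ : IsCalibrated κ J)
    (hD : IsLeviCivita (calibratedMetric κ J) D) (hX : IsSmoothField X) {W : ComplexField E M}
    (hW : W.IsSmooth) :
    (complexify₂ (tensorB D J) W (oneZeroField J X)).2 =
      applyJ J (complexify₂ (tensorB D J) W (oneZeroField J X)).1 := by
  simp only [complexify₂, oneZeroField, tensorB_neg_right hJ _ (hX.applyJ hJ),
    tensorB_applyJ_right hκ hJ hD hW.1 hX,
    tensorB_applyJ_right hκ hJ hD hW.2 hX, applyJ_sub, applyJ_neg, hJ.applyJ_applyJ]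
  abel

theorem complexify_tensorB_oneZeroField_fst (hκ : IsSymplectic κ) (hJ : IsCalibrated κ J)
    (hD : IsLeviCivita (calibratedMetric κ J) D) (hX : IsSmoothField X) (hY : IsSmoothField Y) :
    (complexify₂ (tensorB D J) (oneZeroField J X) (oneZeroField J Y)).1 =
      (4 : ℝ) • applyJ J (nablaJ D J X Y) := by
  simp only [complexify₂, oneZeroField, tensorB_neg_left,
    tensorB_neg_right hJ _ (hY.applyJ hJ), tensorB_applyJ_left hκ hJ hD hX (hY.applyJ hJ),
    tensorB_applyJ_right hκ hJ hD hX hY, applyJ_neg, hJ.applyJ_applyJ, tensorB_eq hκ hJ hD hX hY]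
  module

theorem ComplexField.IsSmooth.nabla (hκ : IsSymplectic κ) (hJ : IsCalibrated κ J)
    (hD : IsLeviCivita (calibratedMetric κ J) D) {Z W : ComplexField E M} (hZ : Z.IsSmooth)
    (hW : W.IsSmooth) : (complexify₂ (nabla D) Z W).IsSmooth :=
  ⟨(hZ.1.nabla hκ hJ hD hW.1).sub (hZ.2.nabla hκ hJ hD hW.2),
    (hZ.1.nabla hκ hJ hD hW.2).add (hZ.2.nabla hκ hJ hD hW.1)⟩

/-- The part of `(∇''_Z B)(W,H)` of type `(1,0)` expresses the composite of two values of `∇J`. -/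
theorem nablaJ_nablaJ_eq_zero (hκ : IsSymplectic κ) (hJ : IsCalibrated κ J)
    (hD : IsLeviCivita (calibratedMetric κ J) D)
    (hB : ∀ Z W H : ComplexField E M, Z.IsSmooth → W.IsSmooth → H.IsSmooth →
      W.IsTypeOneZero J → H.IsTypeOneZero J → nablaZeroOneB D J Z W H = 0)
    {P : ∀ x : M, TangentSpace 𝓘(ℝ, E) x}
    (hP : IsSmoothField P) (hX : IsSmoothField X) (hY : IsSmoothField Y) :
    nablaJ D J P (nablaJ D J X Y) = 0 := by
  have hZ : ComplexField.IsSmooth ((P, applyJ J P) : ComplexField E M) := ⟨hP, hP.applyJ hJ⟩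
  have hWX := isSmooth_oneZeroField hJ hX
  have hWY := isSmooth_oneZeroField hJ hY
  -- The factor 2 cancels the one half in `Z^{(0,1)}`, leaving `P + iJP`.
  have h := hB ((2 : ℝ) • P, 0) _ _ ⟨hP.const_smul 2, .zero⟩ hWX hWY
    (isTypeOneZero_oneZeroField hJ X) (isTypeOneZero_oneZeroField hJ Y)
  rw [nablaZeroOneB, zeroOnePart_two_smul, nablaB] at h
  have e1 := complexify_tensorB_oneZeroField_left hκ hJ hD hX (hZ.nabla hκ hJ hD hWY)
  have e2 := complexify_tensorB_oneZeroField_right hκ hJ hD hY (hZ.nabla hκ hJ hD hWX)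
  have e3 := complexify_tensorB_oneZeroField_left hκ hJ hD hX hWY
  have e4 := complexify_tensorB_oneZeroField_fst hκ hJ hD hX hY
  have hA := hX.nablaJ hκ hJ hD hY
  -- Only the type (0,1) of the correction terms `T` and `U` matters from here on.
  generalize complexify₂ (tensorB D J) (oneZeroField J X)
    (complexify₂ (nabla D) (P, applyJ J P) (oneZeroField J Y)) = T at *
  generalize complexify₂ (tensorB D J) (complexify₂ (nabla D) (P, applyJ J P) (oneZeroField J X))
    (oneZeroField J Y) = U at *
  generalize complexify₂ (tensorB D J) (oneZeroField J X) (oneZeroField J Y) = β at *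
  generalize nablaJ D J X Y = A at *
  have hβ : IsSmoothField β.1 := e4 ▸ (hA.applyJ hJ).const_smul 4
  have h1 := congrArg Prod.fst h
  have h2 := congrArg Prod.snd h
  simp only [complexify₂, Prod.fst_sub, Prod.snd_sub, Prod.fst_zero, Prod.snd_zero, e1, e2, e3]
    at h1 h2
  have h3 := congrArg (applyJ J) h1
  simp only [applyJ_sub, applyJ_zero] at h3
  -- Imaginary part minus `J` of the real part is, up to a factor, the projection to type (1,0); it
  -- removes `T` and `U`.
  have h4 : nablaJ D J P β.1 + applyJ J (nablaJ D J (applyJ J P) β.1) = 0 := by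
    simp only [nablaJ, applyJ_sub, hJ.applyJ_applyJ]
    linear_combination (norm := module) h2 - h3
  -- The quasi-Kähler identity makes both summands equal to `A_P β.1`. With `β.1 = 4 J A` the sum is
  -- `-8 J (A_P A)`, whence the factor `8⁻¹` at the end.
  rw [nablaJ_applyJ_left hκ hJ hD hP hβ, applyJ_neg, hJ.applyJ_applyJ, neg_neg, e4,
    nablaJ_smul_right D hJ P 4 (hA.applyJ hJ), nablaJ_applyJ_right D hJ P hA] at h4
  have h5 := congrArg (applyJ J) h4
  simp only [applyJ_add, applyJ_smul, applyJ_neg, applyJ_zero, hJ.applyJ_applyJ] at h5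
  linear_combination (norm := module) (8⁻¹ : ℝ) • h5

theorem nablaJ_eq_zero (hκ : IsSymplectic κ) (hJ : IsCalibrated κ J)
    (hD : IsLeviCivita (calibratedMetric κ J) D)
    (hB : ∀ Z W H : ComplexField E M, Z.IsSmooth → W.IsSmooth → H.IsSmooth →
      W.IsTypeOneZero J → H.IsTypeOneZero J → nablaZeroOneB D J Z W H = 0)
    (hX : IsSmoothField X) (hY : IsSmoothField Y) : nablaJ D J X Y = 0 := by
  ext x
  by_contra hne
  -- A skew-adjoint operator whose square is zero vanishes when the metric is definite.
  have h1 := calibratedMetric_nablaJ_left (X := X) hκ hJ hD (hX.nablaJ hκ hJ hD hY) hY x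
  rw [nablaJ_nablaJ_eq_zero hκ hJ hD hB hX hX hY, Pi.zero_apply, map_zero, zero_apply] at h1
  have h2 : 0 < calibratedMetric κ J x (nablaJ D J X Y x) (nablaJ D J X Y x) := hJ.pos x _ hne
  linarith

end Rigidity
end AlmostKahler

theorem theorem2 {E : Type*} [NormedAddCommGroup E] [NormedSpace ℝ E] [FiniteDimensional ℝ E]
    {M : Type*} [TopologicalSpace M] [T2Space M] [ChartedSpace E M] [IsManifold 𝓘(ℝ, E) ∞ M]
    (κ : ∀ x : M, TangentSpace 𝓘(ℝ, E) x →L[ℝ] TangentSpace 𝓘(ℝ, E) x →L[ℝ] ℝ)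
    (hκ : AlmostKahler.IsSymplectic κ)
    (J : ∀ x : M, TangentSpace 𝓘(ℝ, E) x →L[ℝ] TangentSpace 𝓘(ℝ, E) x)
    (hJ : AlmostKahler.IsCalibrated κ J)
    (hB : ∀ Z W H : AlmostKahler.ComplexField E M, Z.IsSmooth → W.IsSmooth → H.IsSmooth →
      W.IsTypeOneZero J → H.IsTypeOneZero J →
      AlmostKahler.nablaZeroOneB (AlmostKahler.leviCivita hκ hJ) J Z W H = 0) :
    (∀ X Y : ∀ x : M, TangentSpace 𝓘(ℝ, E) x,
      AlmostKahler.IsSmoothField X → AlmostKahler.IsSmoothField Y →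
        AlmostKahler.nijenhuis J X Y = 0) ∧
    (∀ X Y : ∀ x : M, TangentSpace 𝓘(ℝ, E) x,
      AlmostKahler.IsSmoothField X → AlmostKahler.IsSmoothField Y →
        AlmostKahler.nablaJ (AlmostKahler.leviCivita hκ hJ) J X Y = 0) ∧
    AlmostKahler.IsKahler (AlmostKahler.calibratedMetric κ J) J κ := by
  have hA := fun X Y hX hY => AlmostKahler.nablaJ_eq_zero (X := X) (Y := Y) hκ hJ
    (AlmostKahler.leviCivita_spec hκ hJ) hB hX hY
  have hN := fun X Y hX hY => AlmostKahler.nijenhuis_eq_zero_of_nablaJ_eq_zero (X := X) (Y := Y) hJ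
    (AlmostKahler.leviCivita_spec hκ hJ) hA hX hY
  exact ⟨hN, hA, hκ, hJ, hN, rfl⟩
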